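/- Let $n,m\ge 0$ be integers, $A\in M_n(\mathbb R)$ and $B\in M_{n\times m}(\mathbb R)$, and suppose that the pair $(A,B)$ is controllable, i.e. $\operatorname{rank}[B,\,AB,\,\dots,\,A^{n-1}B]=n$. Let $$\mathcal S_s=\{K\in M_{m\times n}(\mathbb R): \rho(A-BK)<1\}$$ be the set of Schur stabilizing state-feedback gains, where $\rho(M)$ denotes the spectral radius of $M$, i.e. the largest modulus of a complex eigenvalue of $M$ (and $\rho(M)=0$ if $M$ is the empty $0\times 0$ matrix). Then $\mathcal S_s$, with the subspace topology inherited from the Euclidean topology of $M_{m\times n}(\mathbb R)$, is a contractible topological space. -/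

import Mathlib

/-- The Kalman controllability matrix `[B, AB, …, A^(n-1) B]`; the column with index `(k, j)` is
the `j`-th column of the block `A ^ k * B`. -/
def controllabilityMatrix {n m : ℕ} (A : Matrix (Fin n) (Fin n) ℝ) (B : Matrix (Fin n) (Fin m) ℝ) :
    Matrix (Fin n) (Fin n × Fin m) ℝ :=
  Matrix.of fun i kj => (A ^ (kj.1 : ℕ) * B) i kj.2

/-- The Kalman rank condition. -/
def IsControllable {n m : ℕ} (A : Matrix (Fin n) (Fin n) ℝ) (B : Matrix (Fin n) (Fin m) ℝ) : Prop :=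
  (controllabilityMatrix A B).rank = n

/-- A real square matrix is Schur stable if its spectral radius, the supremum of the moduli of its
complex eigenvalues, is less than `1`. -/
def IsSchurStable {n : ℕ} (M : Matrix (Fin n) (Fin n) ℝ) : Prop :=
  spectralRadius ℂ (M.map (algebraMap ℝ ℂ)) < 1

/-- The set of gains `K ∈ M_{m × n}(ℝ)` for which `A - B K` is Schur stable. -/
def schurStabilizingGains {n m : ℕ} (A : Matrix (Fin n) (Fin n) ℝ)
    (B : Matrix (Fin n) (Fin m) ℝ) : Set (Matrix (Fin m) (Fin n) ℝ) :=
  {K | IsSchurStable (A - B * K)}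

/-!
The stabilizing gains form a retract of a nonempty convex set, and a retract of a contractible space
is contractible.

If `M = A - B * K` is Schur stable, the Stein equation `P - M * P * Mᵀ = 1` has exactly one solution
`P`, which is positive definite. The equation is linear in `P`, with invertible coefficient matrix
`1 - M ⊗ₖ M`, so `P` depends continuously on `K` (`continuousAt_steinSolution`,
`posDef_steinSolution`). Conversely, if `P` is positive definite and `P - M * P * Mᵀ ≥ 1`, then `M`
is Schur stable (`isSchurStable_of_posSemidef_sub`). In the variables `P` and `L = K * P` this
inequality reads `(P - 1) - (A * P - B * L) * P⁻¹ * (A * P - B * L)ᵀ ≥ 0`, which by the Schur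
complement says that a block matrix affine in `(P, L)` is positive semidefinite. Hence the set
`steinLMI` of its solutions is convex. The map `(P, L) ↦ L * P⁻¹` sends it to the stabilizing gains,
and solving the Stein equation gives a continuous section of this map.

Controllability is only needed for the convex set to be nonempty, that is, for one stabilizing gain
to exist. The states that can be steered to `0` in `k` steps form a chain of subspaces, which for a
controllable pair ends with the whole space at `k = n`. A linear feedback that moves each subspace of
the chain into the previous one makes the closed loop nilpotent (`exists_feedback_pow_eq_zero`).
-/

/-! ### Deadbeat feedback -/

section Deadbeat

variable {F V U : Type*} [Field F] [AddCommGroup V] [Module F V] [AddCommGroup U] [Module F U]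

/-- The states that the input of `x ↦ A x + B u` can reach from `0` in `k` steps, namely
`im B + A (im B) + ⋯ + A ^ (k - 1) (im B)`. -/
def reachableSubspace (A : V →ₗ[F] V) (B : U →ₗ[F] V) (k : ℕ) : Submodule F V :=
  ⨆ j < k, LinearMap.range ((A ^ j).comp B)

/-- The states that the input of `x ↦ A x - B u` can steer to `0` in `k` steps: those `x` for which
`A ^ k x` is reachable from `0` in `k` steps. -/
def nullControllableSubspace (A : V →ₗ[F] V) (B : U →ₗ[F] V) (k : ℕ) : Submodule F V :=
  (reachableSubspace A B k).comap (A ^ k)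

variable (A : V →ₗ[F] V) (B : U →ₗ[F] V)

lemma reachableSubspace_succ (k : ℕ) :
    reachableSubspace A B (k + 1) =
      reachableSubspace A B k ⊔ LinearMap.range ((A ^ k).comp B) :=
  Nat.iSup_lt_succ _ _

lemma apply_mem_reachableSubspace_succ {k : ℕ} {x : V} (hx : x ∈ reachableSubspace A B k) :
    A x ∈ reachableSubspace A B (k + 1) := by
  have h : reachableSubspace A B k ≤ (reachableSubspace A B (k + 1)).comap A := by
    refine iSup₂_le fun j hj => ?_
    rintro _ ⟨u, rfl⟩
    have h2 : LinearMap.range ((A ^ (j + 1)).comp B) ≤ reachableSubspace A B (k + 1) :=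
      le_iSup₂_of_le (j + 1) (by omega) le_rfl
    exact h2 ⟨u, by simp [pow_succ']⟩
  exact h hx

lemma nullControllableSubspace_zero : nullControllableSubspace A B 0 = ⊥ := by
  ext x
  simp [nullControllableSubspace, reachableSubspace]

lemma nullControllableSubspace_mono : Monotone (nullControllableSubspace A B) := by
  refine monotone_nat_of_le_succ fun k x hx => ?_
  have := apply_mem_reachableSubspace_succ A B (Submodule.mem_comap.1 hx)
  simpa [nullControllableSubspace, pow_succ'] using this

lemma exists_sub_mem_nullControllableSubspace {k : ℕ} {x : V}
    (hx : x ∈ nullControllableSubspace A B (k + 1)) :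
    ∃ u, A x - B u ∈ nullControllableSubspace A B k := by
  have hx' : (A ^ (k + 1)) x ∈ reachableSubspace A B (k + 1) := hx
  rw [reachableSubspace_succ, Submodule.mem_sup] at hx'
  obtain ⟨y, hy, _, ⟨u, rfl⟩, hyz⟩ := hx'
  refine ⟨u, ?_⟩
  have : (A ^ k) (A x - B u) = y := by
    rw [pow_succ, Module.End.mul_apply] at hyz
    rw [map_sub, ← hyz]
    simp
  simpa [nullControllableSubspace, this] using hy

/-- The inputs that drive `nullControllableSubspace A B (k + 1)` into
`nullControllableSubspace A B k` can be chosen linearly in the state. -/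
lemma exists_linear_sub_mem_nullControllableSubspace (k : ℕ) :
    ∃ G : V →ₗ[F] U, ∀ x ∈ nullControllableSubspace A B (k + 1),
      A x - B (G x) ∈ nullControllableSubspace A B k := by
  set S := nullControllableSubspace A B k
  set T := nullControllableSubspace A B (k + 1)
  let φ : U →ₗ[F] V ⧸ S := S.mkQ.comp B
  let ψ : T →ₗ[F] V ⧸ S := (S.mkQ.comp A).comp T.subtype
  have hψ : ∀ x, ψ x ∈ LinearMap.range φ := fun x => by
    obtain ⟨u, hu⟩ := exists_sub_mem_nullControllableSubspace A B x.2
    exact ⟨u, ((Submodule.Quotient.eq S).2 hu).symm⟩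
  obtain ⟨h, hh⟩ := Module.projective_lifting_property φ.rangeRestrict
    (ψ.codRestrict _ hψ) φ.surjective_rangeRestrict
  obtain ⟨G, hG⟩ := LinearMap.exists_extend h
  refine ⟨G, fun x hx => (Submodule.Quotient.eq S).1 ?_⟩
  have h1 : G x = h ⟨x, hx⟩ := LinearMap.congr_fun hG ⟨x, hx⟩
  have h2 := congrArg Subtype.val (LinearMap.congr_fun hh ⟨x, hx⟩)
  rw [h1]
  exact h2.symm

/-- A single feedback descends the first `k` steps of the chain of null controllable subspaces. It
is built up along the chain: on a complement of the `k`-th subspace it can be redefined freely. -/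
lemma exists_feedback_descending (k : ℕ) :
    ∃ K : V →ₗ[F] U, ∀ j < k, ∀ x ∈ nullControllableSubspace A B (j + 1),
      A x - B (K x) ∈ nullControllableSubspace A B j := by
  induction k with
  | zero => exact ⟨0, by simp⟩
  | succ k ih =>
    obtain ⟨K, hK⟩ := ih
    obtain ⟨G, hG⟩ := exists_linear_sub_mem_nullControllableSubspace A B k
    obtain ⟨p, hp⟩ := LinearMap.exists_leftInverse_of_injective
      (nullControllableSubspace A B k).subtype (Submodule.ker_subtype _)
    have hp' : ∀ x ∈ nullControllableSubspace A B k, (p x : V) = x := fun x hx =>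
      congrArg Subtype.val (LinearMap.congr_fun hp ⟨x, hx⟩)
    let q : V →ₗ[F] V := (nullControllableSubspace A B k).subtype.comp p
    refine ⟨K.comp q + G.comp (LinearMap.id - q), fun j hj x hx => ?_⟩
    have key : A x - B ((K.comp q + G.comp (LinearMap.id - q) : V →ₗ[F] U) x) =
        (A (q x) - B (K (q x))) + (A (x - q x) - B (G (x - q x))) := by
      simp only [LinearMap.add_apply, LinearMap.comp_apply, LinearMap.sub_apply,
        LinearMap.id_apply, map_add, map_sub]
      abel
    rw [key]
    rcases Nat.lt_succ_iff_lt_or_eq.1 hj with hj | rfl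
    · have hq : q x = x := hp' x (nullControllableSubspace_mono A B hj hx)
      simpa [hq] using hK j hj x hx
    · have hqx : q x ∈ nullControllableSubspace A B j := (p x).2
      refine add_mem ?_ (hG _ (sub_mem hx (nullControllableSubspace_mono A B j.le_succ hqx)))
      cases j with
      | zero =>
        have : q x = 0 := by simpa [nullControllableSubspace_zero] using hqx
        simp [this]
      | succ i => exact nullControllableSubspace_mono A B i.le_succ (hK i (by omega) _ hqx)

/-- Deadbeat control: if every state is reachable in `k` steps, some feedback makes the closed loop
nilpotent. -/
theorem exists_feedback_pow_eq_zero {k : ℕ} (h : reachableSubspace A B k = ⊤) :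
    ∃ K : V →ₗ[F] U, (A - B.comp K) ^ k = 0 := by
  obtain ⟨K, hK⟩ := exists_feedback_descending A B k
  refine ⟨K, ?_⟩
  have key : ∀ j ≤ k, ∀ x ∈ nullControllableSubspace A B j, ((A - B.comp K) ^ j) x = 0 := by
    intro j
    induction j with
    | zero => intro _ x hx; simpa [nullControllableSubspace_zero] using hx
    | succ j ih =>
      intro hj x hx
      rw [pow_succ, Module.End.mul_apply]
      exact ih (by omega) _ (hK j hj x hx)
  ext x
  exact key k le_rfl x (by simp [nullControllableSubspace, h])

end Deadbeat

open Matrix in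
theorem IsControllable.reachableSubspace_eq_top {n m : ℕ} {A : Matrix (Fin n) (Fin n) ℝ}
    {B : Matrix (Fin n) (Fin m) ℝ} (h : IsControllable A B) :
    reachableSubspace (toLin' A) (toLin' B) n = ⊤ := by
  have hr : LinearMap.range (controllabilityMatrix A B).mulVecLin = ⊤ :=
    Submodule.eq_top_of_finrank_eq (by simpa [IsControllable, Matrix.rank] using h)
  rw [eq_top_iff, ← hr, Matrix.range_mulVecLin, Submodule.span_le]
  rintro _ ⟨⟨k, j⟩, rfl⟩
  have h2 : LinearMap.range (((toLin' A) ^ (k : ℕ)).comp (toLin' B)) ≤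
      reachableSubspace (toLin' A) (toLin' B) n := le_iSup₂_of_le (k : ℕ) k.2 le_rfl
  refine h2 ⟨Pi.single j 1, ?_⟩
  rw [← toLin'_pow, ← toLin'_mul, toLin'_apply, mulVec_single_one]
  rfl

open scoped Matrix.Norms.Operator in
theorem isSchurStable_of_pow_eq_zero {n k : ℕ} {M : Matrix (Fin n) (Fin n) ℝ} (h : M ^ k = 0) :
    IsSchurStable M := by
  -- The exponent `k + 1` is positive even when `k = 0`, which can occur for the empty matrix.
  have h0 : (M.map (algebraMap ℝ ℂ)) ^ (k + 1) = 0 := by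
    rw [← Matrix.map_pow, pow_succ, h]
    simp
  have h1 := spectrum.spectralRadius_pow_le (𝕜 := ℂ) (M.map (algebraMap ℝ ℂ)) (k + 1) (by omega)
  rw [h0, spectrum.spectralRadius_zero, nonpos_iff_eq_zero] at h1
  rw [IsSchurStable, pow_eq_zero_iff (by omega) |>.1 h1]
  exact one_pos

theorem IsControllable.schurStabilizingGains_nonempty {n m : ℕ} {A : Matrix (Fin n) (Fin n) ℝ}
    {B : Matrix (Fin n) (Fin m) ℝ} (h : IsControllable A B) :
    (schurStabilizingGains A B).Nonempty := by
  obtain ⟨K, hK⟩ := exists_feedback_pow_eq_zero _ _ h.reachableSubspace_eq_top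
  refine ⟨LinearMap.toMatrix' K, isSchurStable_of_pow_eq_zero (k := n) ?_⟩
  apply Matrix.toLin'.injective
  rw [Matrix.toLin'_pow, map_sub, Matrix.toLin'_mul, Matrix.toLin'_toMatrix', hK, map_zero]

/-! ### Schur stability and convergence of powers -/

section SchurStable

open Filter Topology ENNReal NNReal

theorem tendsto_pow_nhds_zero_of_spectralRadius_lt_one {R : Type*} [NormedRing R]
    [NormedAlgebra ℂ R] [CompleteSpace R] {a : R} (h : spectralRadius ℂ a < 1) :
    Tendsto (fun k => a ^ k) atTop (𝓝 0) := by
  obtain ⟨r, hr, hr1⟩ := ENNReal.lt_iff_exists_nnreal_btwn.1 h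
  have hr1' : (r : ℝ) < 1 := by exact_mod_cast hr1
  refine squeeze_zero_norm' ?_ (tendsto_pow_atTop_nhds_zero_of_lt_one r.2 hr1')
  filter_upwards [(spectrum.pow_nnnorm_pow_one_div_tendsto_nhds_spectralRadius a).eventually_lt_const
    hr, eventually_gt_atTop 0] with k hk hk0
  have hk0' : (k : ℝ) ≠ 0 := by positivity
  have h1 := ENNReal.rpow_le_rpow hk.le (Nat.cast_nonneg (α := ℝ) k)
  rw [← ENNReal.rpow_mul, one_div, inv_mul_cancel₀ hk0', ENNReal.rpow_one,
    ENNReal.rpow_natCast] at h1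
  exact_mod_cast h1

open scoped Matrix.Norms.Operator in
theorem IsSchurStable.tendsto_pow {n : ℕ} {M : Matrix (Fin n) (Fin n) ℝ} (h : IsSchurStable M) :
    Tendsto (fun k => M ^ k) atTop (𝓝 0) := by
  have h1 := tendsto_pow_nhds_zero_of_spectralRadius_lt_one h
  have hc : Continuous fun N : Matrix (Fin n) (Fin n) ℂ => N.map Complex.re :=
    continuous_id.matrix_map Complex.continuous_re
  have h2 := (hc.tendsto 0).comp h1
  convert h2 using 2 with k
  · ext i j
    rw [Function.comp_apply, ← Matrix.map_pow]
    simp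
  · ext i j
    simp

open scoped Matrix.Norms.Operator in
theorem isSchurStable_of_forall_mem_spectrum {n : ℕ} {M : Matrix (Fin n) (Fin n) ℝ}
    (h : ∀ z ∈ spectrum ℂ (M.map (algebraMap ℝ ℂ)), ‖z‖ < 1) : IsSchurStable M := by
  -- The spectrum is nonempty only in a nontrivial algebra, so `n = 0` is treated separately.
  rcases subsingleton_or_nontrivial (Matrix (Fin n) (Fin n) ℂ) with _ | _
  · rw [IsSchurStable, spectrum.SpectralRadius.of_subsingleton]
    exact one_pos
  · exact spectrum.spectralRadius_lt_of_forall_lt (r := 1) _ fun z hz => h z hz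

end SchurStable

/-! ### The Stein equation -/

section Stein

open Matrix Filter Topology Kronecker

variable {ι : Type*} [Fintype ι] [DecidableEq ι]

/-- The solution `X` of the Stein (discrete Lyapunov) equation `X - M * X * Mᵀ = 1`, obtained by
solving the equivalent linear system with matrix `1 - M ⊗ₖ M` for the vectorization of `X`. It is
meaningful when that matrix is invertible, in particular when the powers of `M` tend to `0`. The
indices are swapped because `vec` stacks columns. -/
noncomputable def steinSolution (M : Matrix ι ι ℝ) : Matrix ι ι ℝ :=
  of fun i j => ((1 - M ⊗ₖ M)⁻¹ *ᵥ vec 1) (j, i)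

lemma one_sub_kronecker_mulVec_vec (M X : Matrix ι ι ℝ) :
    (1 - M ⊗ₖ M) *ᵥ vec X = vec (X - M * X * Mᵀ) := by
  rw [sub_mulVec, one_mulVec, kronecker_mulVec_vec, vec_sub]

lemma tendsto_pow_mul_mul_pow_transpose {M : Matrix ι ι ℝ}
    (hM : Tendsto (fun k => M ^ k) atTop (𝓝 0)) (X : Matrix ι ι ℝ) :
    Tendsto (fun k => M ^ k * X * (M ^ k)ᵀ) atTop (𝓝 0) := by
  have hc : Continuous fun N : Matrix ι ι ℝ => N * X * Nᵀ := by fun_prop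
  have h := (hc.tendsto 0).comp hM
  rwa [Matrix.zero_mul, Matrix.zero_mul] at h

lemma eq_zero_of_eq_mul_mul_transpose {M X : Matrix ι ι ℝ}
    (hM : Tendsto (fun k => M ^ k) atTop (𝓝 0)) (hX : X = M * X * Mᵀ) : X = 0 := by
  have h : ∀ k : ℕ, M ^ k * X * (M ^ k)ᵀ = X := by
    intro k
    induction k with
    | zero => simp
    | succ k ih =>
      calc M ^ (k + 1) * X * (M ^ (k + 1))ᵀ = M ^ k * (M * X * Mᵀ) * (M ^ k)ᵀ := by
            rw [pow_succ, transpose_mul]; simp only [Matrix.mul_assoc]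
        _ = X := by rw [← hX, ih]
  have h1 := tendsto_pow_mul_mul_pow_transpose hM X
  simp only [h] at h1
  exact tendsto_nhds_unique tendsto_const_nhds h1

lemma det_one_sub_kronecker_ne_zero {M : Matrix ι ι ℝ}
    (hM : Tendsto (fun k => M ^ k) atTop (𝓝 0)) : (1 - M ⊗ₖ M).det ≠ 0 := by
  intro h
  obtain ⟨v, hv, hv0⟩ := exists_mulVec_eq_zero_iff.2 h
  obtain ⟨X, rfl⟩ := vec_bijective.surjective v
  rw [one_sub_kronecker_mulVec_vec, vec_eq_zero_iff, sub_eq_zero] at hv0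
  exact hv (vec_eq_zero_iff.2 (eq_zero_of_eq_mul_mul_transpose hM hv0))

theorem steinSolution_sub {M : Matrix ι ι ℝ} (hM : Tendsto (fun k => M ^ k) atTop (𝓝 0)) :
    steinSolution M - M * steinSolution M * Mᵀ = 1 := by
  have hu : IsUnit (1 - M ⊗ₖ M).det := (det_one_sub_kronecker_ne_zero hM).isUnit
  have hv : vec (steinSolution M) = (1 - M ⊗ₖ M)⁻¹ *ᵥ vec 1 := rfl
  rw [← vec_inj, ← one_sub_kronecker_mulVec_vec, hv, mulVec_mulVec, mul_nonsing_inv _ hu,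
    one_mulVec]

theorem continuousAt_steinSolution {M : Matrix ι ι ℝ}
    (hM : Tendsto (fun k => M ^ k) atTop (𝓝 0)) : ContinuousAt steinSolution M := by
  have hc : Continuous fun N : Matrix ι ι ℝ => 1 - N ⊗ₖ N := by
    exact continuous_const.sub (continuous_matrix fun i j =>
      (continuous_id.matrix_elem i.1 j.1).mul (continuous_id.matrix_elem i.2 j.2))
  have hinv : ContinuousAt Inv.inv (1 - M ⊗ₖ M) := by
    apply continuousAt_matrix_inv
    rw [Ring.inverse_eq_inv']
    exact continuousAt_inv₀ (det_one_sub_kronecker_ne_zero hM)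
  have h1 : ContinuousAt (fun N : Matrix ι ι ℝ => (1 - N ⊗ₖ N)⁻¹) M :=
    ContinuousAt.comp (f := fun N : Matrix ι ι ℝ => 1 - N ⊗ₖ N) hinv hc.continuousAt
  have h2 : Continuous fun Q : Matrix (ι × ι) (ι × ι) ℝ =>
      (of fun i j => (Q *ᵥ vec 1) (j, i) : Matrix ι ι ℝ) :=
    continuous_matrix fun i j =>
      (continuous_apply (j, i)).comp (continuous_id.matrix_mulVec continuous_const)
  exact h2.continuousAt.comp h1

lemma isHermitian_steinSolution {M : Matrix ι ι ℝ}
    (hM : Tendsto (fun k => M ^ k) atTop (𝓝 0)) : (steinSolution M).IsHermitian := by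
  have h := steinSolution_sub hM
  have ht := congrArg transpose h
  simp only [transpose_sub, transpose_mul, transpose_transpose, transpose_one] at ht
  rw [IsHermitian, conjTranspose_eq_transpose_of_trivial, ← sub_eq_zero]
  apply eq_zero_of_eq_mul_mul_transpose hM
  rw [Matrix.mul_sub, Matrix.sub_mul, ← sub_eq_zero, sub_sub_sub_comm, h, Matrix.mul_assoc M, ht,
    sub_self]

/-- Iterating the Stein equation shows that `X - M ^ k * X * (M ^ k)ᵀ` is positive semidefinite for
every `k`, and `k → ∞` gives that `X` itself is. -/
theorem posDef_steinSolution {M : Matrix ι ι ℝ} (hM : Tendsto (fun k => M ^ k) atTop (𝓝 0)) :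
    (steinSolution M).PosDef := by
  have h := steinSolution_sub hM
  set X := steinSolution M with hXdef
  have hk : ∀ k : ℕ, (X - M ^ k * X * (M ^ k)ᵀ).PosSemidef := by
    intro k
    induction k with
    | zero => simpa using PosSemidef.zero
    | succ k ih =>
      have e : X - M ^ (k + 1) * X * (M ^ (k + 1))ᵀ =
          1 + M * (X - M ^ k * X * (M ^ k)ᵀ) * Mᵀ := by
        rw [← h, pow_succ', transpose_mul, Matrix.mul_sub, Matrix.sub_mul]
        simp only [Matrix.mul_assoc]
        abel
      rw [e]
      simpa using PosSemidef.one.add (ih.mul_mul_conjTranspose_same M)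
  have hpsd : X.PosSemidef := by
    refine .of_dotProduct_mulVec_nonneg (isHermitian_steinSolution hM) fun x => ?_
    have hc : Continuous fun N : Matrix ι ι ℝ => star x ⬝ᵥ ((X - N) *ᵥ x) := by fun_prop
    have h1 := (hc.tendsto 0).comp (tendsto_pow_mul_mul_pow_transpose hM X)
    rw [sub_zero] at h1
    exact ge_of_tendsto' h1 fun k => (hk k).dotProduct_mulVec_nonneg x
  rw [← sub_add_cancel X (M * X * Mᵀ), h]
  simpa using PosDef.one.add_posSemidef (hpsd.mul_mul_conjTranspose_same M)

/-- The discrete Lyapunov stability criterion. For a left eigenvector `a + b i` of `M` with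
eigenvalue `z`, the quadratic form of `P` satisfies
`P(Mᵀ a) + P(Mᵀ b) = |z| ^ 2 (P(a) + P(b))`. -/
theorem isSchurStable_of_posSemidef_sub {n : ℕ} {M P : Matrix (Fin n) (Fin n) ℝ} (hP : P.PosDef)
    (h : (P - 1 - M * P * Mᵀ).PosSemidef) : IsSchurStable M := by
  refine isSchurStable_of_forall_mem_spectrum fun z hz => ?_
  rw [spectrum.mem_iff, isUnit_iff_isUnit_det, isUnit_iff_ne_zero, not_not,
    ← exists_vecMul_eq_zero_iff] at hz
  -- `v` is a left eigenvector with real part `a` and imaginary part `b`.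
  obtain ⟨v, hv0, hv⟩ := hz
  rw [vecMul_sub, sub_eq_zero, Algebra.algebraMap_eq_smul_one, vecMul_smul, vecMul_one] at hv
  let a : Fin n → ℝ := fun i => (v i).re
  let b : Fin n → ℝ := fun i => (v i).im
  have ha : Mᵀ *ᵥ a = z.re • a - z.im • b := by
    ext i
    have := congrArg Complex.re (congrFun hv i)
    simpa [vecMul, mulVec, dotProduct, a, b, mul_comm] using this.symm
  have hb : Mᵀ *ᵥ b = z.re • b + z.im • a := by
    ext i
    have := congrArg Complex.im (congrFun hv i)
    simpa [vecMul, mulVec, dotProduct, a, b, mul_comm] using this.symm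
  have hq : ∀ x : Fin n → ℝ, (Mᵀ *ᵥ x) ⬝ᵥ (P *ᵥ (Mᵀ *ᵥ x)) ≤ x ⬝ᵥ (P *ᵥ x) - x ⬝ᵥ x := by
    intro x
    have := h.dotProduct_mulVec_nonneg x
    have e : x ⬝ᵥ ((M * P * Mᵀ) *ᵥ x) = (Mᵀ *ᵥ x) ⬝ᵥ (P *ᵥ (Mᵀ *ᵥ x)) := by
      rw [← mulVec_mulVec, ← mulVec_mulVec, dotProduct_mulVec, ← mulVec_transpose]
    simp only [star_trivial, sub_mulVec, one_mulVec, dotProduct_sub, e] at this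
    linarith
  have hsymm : b ⬝ᵥ (P *ᵥ a) = a ⬝ᵥ (P *ᵥ b) := by
    have hPt : Pᵀ = P := by simpa using hP.isHermitian.eq
    rw [dotProduct_mulVec, ← mulVec_transpose, hPt, dotProduct_comm]
  have hqa := hq a
  have hqb := hq b
  simp only [ha, hb, mulVec_add, mulVec_sub, mulVec_smul, dotProduct_add, dotProduct_sub,
    add_dotProduct, sub_dotProduct, dotProduct_smul, smul_dotProduct, smul_eq_mul, hsymm]
    at hqa hqb
  have hnn : ∀ x : Fin n → ℝ, 0 ≤ x ⬝ᵥ (P *ᵥ x) := fun x => by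
    simpa using hP.posSemidef.dotProduct_mulVec_nonneg x
  have hpos : 0 < a ⬝ᵥ a + b ⬝ᵥ b := by
    have hsum : a ⬝ᵥ a + b ⬝ᵥ b = ∑ i, Complex.normSq (v i) := by
      simp [dotProduct, a, b, Complex.normSq_apply, Finset.sum_add_distrib]
    obtain ⟨i, hi⟩ := Function.ne_iff.1 hv0
    rw [hsum]
    exact Finset.sum_pos' (fun _ _ => Complex.normSq_nonneg _)
      ⟨i, Finset.mem_univ i, Complex.normSq_pos.2 hi⟩
  have hz2 : ‖z‖ ^ 2 = z.re * z.re + z.im * z.im := by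
    rw [Complex.sq_norm, Complex.normSq_apply]
  have hmain : ‖z‖ ^ 2 * (a ⬝ᵥ (P *ᵥ a) + b ⬝ᵥ (P *ᵥ b)) <
      1 * (a ⬝ᵥ (P *ᵥ a) + b ⬝ᵥ (P *ᵥ b)) := by
    rw [hz2]
    linarith
  have := lt_of_mul_lt_mul_right hmain (add_nonneg (hnn a) (hnn b))
  exact (sq_lt_one_iff₀ (norm_nonneg z)).1 this

end Stein

/-! ### A convex set that retracts onto the stabilizing gains -/

section Contractible

open Matrix

theorem ContractibleSpace.of_retract {X Y : Type*} [TopologicalSpace X] [TopologicalSpace Y]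
    [ContractibleSpace X] (r : C(X, Y)) (s : C(Y, X)) (h : r.comp s = ContinuousMap.id Y) :
    ContractibleSpace Y := by
  rw [contractible_iff_id_nullhomotopic, ← h]
  simpa using ((id_nullhomotopic X).comp_right r).comp_left s

variable {n m : ℕ} (A : Matrix (Fin n) (Fin n) ℝ) (B : Matrix (Fin n) (Fin m) ℝ)

/-- The solutions `(P, L)`, with `P` positive definite, of the linear matrix inequality that
is the Schur complement form of `P - (A - B * K) * P * (A - B * K)ᵀ ≥ 1`
in the variables `P` and `L = K * P`. -/
def steinLMI : Set (Matrix (Fin n) (Fin n) ℝ × Matrix (Fin m) (Fin n) ℝ) :=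
  {p | p.1.PosDef ∧
    (fromBlocks p.1 (A * p.1 - B * p.2)ᴴ (A * p.1 - B * p.2) (p.1 - 1)).PosSemidef}

theorem convex_steinLMI : Convex ℝ (steinLMI A B) := by
  rw [convex_iff_forall_pos]
  rintro ⟨P, L⟩ ⟨hP, h⟩ ⟨Q, N⟩ ⟨hQ, h'⟩ a b ha hb hab
  refine ⟨(hP.smul ha).add (hQ.smul hb), ?_⟩
  have e := (h.smul ha.le).add (h'.smul hb.le)
  rw [fromBlocks_smul, fromBlocks_smul, fromBlocks_add] at e
  have e1 : a • (A * P - B * L) + b • (A * Q - B * N) =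
      A * (a • P + b • Q) - B * (a • L + b • N) := by
    simp only [Matrix.mul_add, Matrix.mul_smul, smul_sub]
    abel
  have e2 : a • (P - 1) + b • (Q - 1) = (a • P + b • Q) - 1 := by
    rw [smul_sub, smul_sub, sub_add_sub_comm, ← add_smul, hab, one_smul]
  have e3 : a • (A * P - B * L)ᴴ + b • (A * Q - B * N)ᴴ =
      (A * (a • P + b • Q) - B * (a • L + b • N))ᴴ := by
    rw [← e1]
    simp
  rw [e1, e2, e3] at e
  exact e

lemma mem_steinLMI_iff {P : Matrix (Fin n) (Fin n) ℝ} (hP : P.PosDef)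
    (K : Matrix (Fin m) (Fin n) ℝ) :
    (P, K * P) ∈ steinLMI A B ↔ (P - 1 - (A - B * K) * P * (A - B * K)ᵀ).PosSemidef := by
  have hu : IsUnit P.det := (isUnit_iff_isUnit_det P).1 hP.isUnit
  have hPt : Pᵀ = P := by simpa using hP.isHermitian.eq
  have := hP.isUnit.invertible
  have hAB : A * P - B * (K * P) = (A - B * K) * P := by
    rw [Matrix.sub_mul, Matrix.mul_assoc B]
  have h := hP.fromBlocks₁₁ ((A - B * K) * P)ᴴ (P - 1)
  simp only [conjTranspose_conjTranspose] at h
  simp only [steinLMI, Set.mem_ofPred_eq, hP, true_and, hAB, h]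
  rw [conjTranspose_eq_transpose_of_trivial, transpose_mul, hPt, mul_nonsing_inv_cancel_right _ _ hu,
    ← Matrix.mul_assoc]

theorem mul_inv_mem_schurStabilizingGains
    {p : Matrix (Fin n) (Fin n) ℝ × Matrix (Fin m) (Fin n) ℝ} (hp : p ∈ steinLMI A B) :
    p.2 * p.1⁻¹ ∈ schurStabilizingGains A B := by
  obtain ⟨P, L⟩ := p
  have hP : P.PosDef := hp.1
  have hu : IsUnit P.det := (isUnit_iff_isUnit_det P).1 hP.isUnit
  refine isSchurStable_of_posSemidef_sub hP ((mem_steinLMI_iff A B hP _).1 ?_)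
  rwa [nonsing_inv_mul_cancel_right _ _ hu]

theorem steinSolution_mem_steinLMI {K : Matrix (Fin m) (Fin n) ℝ}
    (hK : K ∈ schurStabilizingGains A B) :
    (steinSolution (A - B * K), K * steinSolution (A - B * K)) ∈ steinLMI A B := by
  have hM := IsSchurStable.tendsto_pow hK
  rw [mem_steinLMI_iff A B (posDef_steinSolution hM), sub_right_comm, steinSolution_sub hM, sub_self]
  exact PosSemidef.zero

/-- The gain `K = L * P⁻¹` encoded by a solution `(P, L)` of the matrix inequality. -/
noncomputable def gainOfSteinLMI : C(steinLMI A B, schurStabilizingGains A B) where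
  toFun p := ⟨p.1.2 * p.1.1⁻¹, mul_inv_mem_schurStabilizingGains A B p.2⟩
  continuous_toFun := by
    refine Continuous.subtype_mk (Continuous.matrix_mul (by fun_prop) ?_) _
    refine continuous_iff_continuousAt.2 fun p => ?_
    refine ContinuousAt.comp (f := fun p : steinLMI A B => p.1.1) (g := Inv.inv) ?_ (by fun_prop)
    apply continuousAt_matrix_inv
    rw [Ring.inverse_eq_inv']
    exact continuousAt_inv₀ ((isUnit_iff_isUnit_det _).1 p.2.1.isUnit).ne_zero

/-- The section of `gainOfSteinLMI` that solves the Stein equation of the closed loop. -/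
noncomputable def steinLMIOfGain : C(schurStabilizingGains A B, steinLMI A B) where
  toFun K := ⟨_, steinSolution_mem_steinLMI A B K.2⟩
  continuous_toFun := by
    have h : Continuous fun K : schurStabilizingGains A B => steinSolution (A - B * K.1) := by
      refine continuous_iff_continuousAt.2 fun K => ?_
      exact ContinuousAt.comp (f := fun K : schurStabilizingGains A B => A - B * K.1)
        (continuousAt_steinSolution (IsSchurStable.tendsto_pow K.2)) (by fun_prop)
    exact (h.prodMk (continuous_subtype_val.matrix_mul h)).subtype_mk _

theorem gainOfSteinLMI_comp_steinLMIOfGain :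
    (gainOfSteinLMI A B).comp (steinLMIOfGain A B) = ContinuousMap.id _ := by
  ext1 K
  have hP := posDef_steinSolution (IsSchurStable.tendsto_pow K.2)
  exact Subtype.ext (mul_nonsing_inv_cancel_right _ _ ((isUnit_iff_isUnit_det _).1 hP.isUnit))

end Contractible

theorem mainTheorem2 {n m : ℕ} (A : Matrix (Fin n) (Fin n) ℝ) (B : Matrix (Fin n) (Fin m) ℝ)
    (hAB : IsControllable A B) :
    ContractibleSpace (schurStabilizingGains A B) := by
  obtain ⟨K, hK⟩ := hAB.schurStabilizingGains_nonempty
  have := (convex_steinLMI A B).contractibleSpace ⟨_, steinSolution_mem_steinLMI A B hK⟩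
  exact .of_retract _ _ (gainOfSteinLMI_comp_steinLMIOfGain A B)
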